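/- Let $\mathsf{k}$ be a field and let $(\Gamma,x_0)$ be a finite rooted tree, i.e. a finite tree with a distinguished vertex $x_0$ (the root), whose edges are directed away from $x_0$. The level $\ell_\Gamma(x)$ of a vertex $x$ is the length of the path from $x_0$ to $x$, the height $\operatorname{ht}(\Gamma)$ is the maximal level of a vertex, the outdegree $\deg^+_\Gamma(x)$ is the number of edges directed away from $x$, and a leaf is a vertex of outdegree $0$. Suppose that $(\Gamma,x_0)$ is perfect, i.e. every leaf $x$ satisfies $\ell_\Gamma(x)=\operatorname{ht}(\Gamma)$, and that $\operatorname{ht}(\Gamma)\ge 1$. Put $t=\operatorname{ht}(\Gamma)$, let $R$ be the standard graded polynomial ring over $\mathsf{k}$ whose variables are the vertices of $\Gamma$, and let $I_t(\Gamma)\subseteq R$ be the ideal generated by all monomials $y_1\cdots y_t$ such that $y_1,\dots,y_t$ is a directed path on $t$ distinct vertices of $\Gamma$. Then $$\operatorname{reg}\left(\frac{R}{I_t(\Gamma)}\right)=\sum_{x\,:\,0\le \ell_\Gamma(x)\le \operatorname{ht}(\Gamma)-2}\deg^+_\Gamma(x),$$ where the sum is over all vertices $x$ with $\ell_\Gamma(x)\le\operatorname{ht}(\Gamma)-2$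 (so it is $0$ if $\operatorname{ht}(\Gamma)=1$), and $\operatorname{reg}(M)=\max\{j-i:\beta_{i,j}(M)\neq 0\}$ denotes the Castelnuovo–Mumford regularity, with $\beta_{i,j}(M)$ the number of summands $R(-j)$ in homological degree $i$ of the minimal graded free resolution of $M$ over $R$. -/

import Mathlib

/-! ### Rooted trees -/

namespace RootedTree

variable {V : Type*}

/-- The level of `x` in the tree `G` rooted at `x₀`: the length of the path from `x₀` to `x`. -/
noncomputable def level (G : SimpleGraph V) (x₀ x : V) : ℕ := G.dist x₀ x

/-- Directed edges: the edges of `G`, directed away from the root `x₀`. -/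
def DirEdge (G : SimpleGraph V) (x₀ x y : V) : Prop :=
  G.Adj x y ∧ level G x₀ y = level G x₀ x + 1

/-- The outdegree of `x`: the number of edges directed away from `x`. -/
noncomputable def outdegree (G : SimpleGraph V) (x₀ x : V) : ℕ :=
  {y : V | DirEdge G x₀ x y}.ncard

/-- A leaf is a vertex of outdegree `0`. -/
def IsLeaf (G : SimpleGraph V) (x₀ x : V) : Prop := outdegree G x₀ x = 0

/-- The height: the maximal level of a vertex. -/
noncomputable def height [Fintype V] (G : SimpleGraph V) (x₀ : V) : ℕ :=
  Finset.univ.sup (level G x₀)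

/-- `(G, x₀)` is a perfect rooted tree: `G` is a tree and every leaf has level the height. -/
def IsPerfect [Fintype V] (G : SimpleGraph V) (x₀ : V) : Prop :=
  G.IsTree ∧ ∀ x, IsLeaf G x₀ x → level G x₀ x = height G x₀

/-- `p` is a directed path on `t` vertices: a sequence of `t` distinct vertices such that there is
a directed edge from each of them to the next one. -/
def IsDirPath (G : SimpleGraph V) (x₀ : V) (t : ℕ) (p : Fin t → V) : Prop :=
  Function.Injective p ∧ ∀ i j : Fin t, (j : ℕ) = i + 1 → DirEdge G x₀ (p i) (p j)

/-- The `t`-path ideal of the rooted tree `(G, x₀)` in the polynomial ring over `K` whose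
variables are the vertices. -/
noncomputable def pathIdeal (K : Type*) [Field K] (G : SimpleGraph V) (x₀ : V) (t : ℕ) :
    Ideal (MvPolynomial V K) :=
  Ideal.span {m | ∃ p : Fin t → V, IsDirPath G x₀ t p ∧ m = ∏ i, MvPolynomial.X (p i)}

end RootedTree

/-! ### Minimal graded free resolutions and regularity -/

namespace GradedRes

/-- The standard grading of the polynomial ring, indexed by `ℤ` (zero in negative degrees). -/
noncomputable def polyGrading (V K : Type*) [Field K] (n : ℤ) :
    Submodule K (MvPolynomial V K) :=
  if 0 ≤ n then MvPolynomial.homogeneousSubmodule V K n.toNat else ⊥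

/-- The grading induced on the quotient of the polynomial ring by an ideal `I`. -/
noncomputable def quotGrading {V K : Type*} [Field K] (I : Ideal (MvPolynomial V K)) (n : ℤ) :
    Submodule K (MvPolynomial V K ⧸ I) :=
  (polyGrading V K n).map (Ideal.Quotient.mkₐ K I).toLinearMap

/-- A minimal graded free resolution `⋯ → F₁ → F₀ → M → 0` of a graded module `M` over the
polynomial ring, with `F i` the free module with basis `e₁, …, e_(rank i)`, where the basis element
with index `k` is homogeneous of degree `deg i k`; that is, `F i = ⨁ₖ R(-deg i k)`. -/
structure MinimalResolution {V K : Type*} [Field K] {M : Type*} [AddCommGroup M]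
    [Module (MvPolynomial V K) M] [Module K M] (grading : ℤ → Submodule K M) where
  /-- the rank of the `i`-th free module -/
  rank : ℕ → ℕ
  /-- the degrees of the basis elements -/
  deg : (i : ℕ) → Fin (rank i) → ℤ
  /-- the differentials -/
  d : (i : ℕ) → (Fin (rank (i + 1)) → MvPolynomial V K) →ₗ[MvPolynomial V K]
    (Fin (rank i) → MvPolynomial V K)
  /-- the augmentation -/
  aug : (Fin (rank 0) → MvPolynomial V K) →ₗ[MvPolynomial V K] M
  aug_surjective : Function.Surjective aug
  exact_zero : Function.Exact (d 0) aug
  exact_succ : ∀ i, Function.Exact (d (i + 1)) (d i)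
  /-- the augmentation is homogeneous of degree `0` -/
  aug_mem : ∀ k, aug (Pi.single k 1) ∈ grading (deg 0 k)
  /-- the differentials are homogeneous of degree `0` -/
  d_mem : ∀ i k l, d i (Pi.single k 1) l ∈ polyGrading V K (deg (i + 1) k - deg i l)
  /-- minimality: the entries of the differentials lie in the ideal generated by the variables -/
  minimal : ∀ i k l, d i (Pi.single k 1) l ∈
    Ideal.span (Set.range (MvPolynomial.X : V → MvPolynomial V K))

/-- The graded Betti number `β_{i,j}` read off from a minimal graded free resolution: the number of
summands `R(-j)` of its `i`-th free module. -/
def MinimalResolution.betti {V K : Type*} [Field K] {M : Type*} [AddCommGroup M]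
    [Module (MvPolynomial V K) M] [Module K M] {grading : ℤ → Submodule K M}
    (F : MinimalResolution (V := V) grading) (i : ℕ) (j : ℤ) : ℕ :=
  (Finset.univ.filter fun k => F.deg i k = j).card

/-- `r` is the Castelnuovo–Mumford regularity `max {j - i | β_{i,j} ≠ 0}` of the graded module
`R/I`: a minimal graded free resolution exists, and for each of them the maximum exists and
is equal to `r`. -/
def IsRegularityQuot {V K : Type*} [Field K] (I : Ideal (MvPolynomial V K)) (r : ℤ) : Prop :=
  Nonempty (MinimalResolution (V := V) (quotGrading I)) ∧
    ∀ F : MinimalResolution (V := V) (quotGrading I),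
      IsGreatest {a : ℤ | ∃ (i : ℕ) (j : ℤ), F.betti i j ≠ 0 ∧ a = j - i} r

end GradedRes

/-!
Let `t` be the height. A directed path on `t` vertices starts at level `0` or `1`, so it contains
exactly one vertex of the set `A` consisting of the root and the leaves; its other vertices lie in
the set `B` of the vertices at the levels `1, …, t - 1`. Every vertex of `B` has exactly one parent,
which lies at a level at most `t - 2`, so the sum of outdegrees in question is the cardinality of
`B` (`RootedTree.sum_outdegree`).

The regularity is read off from the Taylor resolution of the path ideal (`Taylor.resolution`). Its
basis elements in homological degree `i` are the sets `T` of `i` generators, in the degree of the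
least common multiple of `T`. As each generator is linear in the variables from `A`, this degree is
at most `i + |B|` (`RootedTree.degree_lcmExp_le`). Equality holds for the set of all paths which
avoid the root (`RootedTree.le_degree_lcmExp`): they cover all other vertices and correspond to the
leaves at which they end. Their leaves make these paths irredundant and all other generators involve
the root, so no generator divides the least common multiple of the generators of this set other
than itself (`RootedTree.not_pathExp_le_lcmExp`). Hence this basis element neither occurs with a
unit coefficient in a boundary nor has a boundary with a unit coefficient
(`Taylor.isMinimalAt_resolution`).

The Taylor resolution is rarely minimal, but the comparison of resolutions shows that the degree of
a basis element which is minimal in this sense occurs in every graded free resolution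
(`GradedRes.FreeResolution.IsMinimalAt.exists_deg_eq`): the comparison maps to the other resolution
and back compose to a map homotopic to the identity, and modulo the variables the homotopy does not
affect the coefficient of that basis element. Applied to a minimal resolution and the Taylor
resolution in both orders, this gives the two bounds for the regularity. A minimal resolution exists
because at each stage one can take as few homogeneous generators of the syzygies as possible
(`GradedRes.Components.exists_minimal_generators`).

The Taylor complex is exact because multiplication by the least common multiples embeds it into the
chain complex of a simplex with polynomial coefficients, and the contraction of the simplex that
joins each monomial with a generator dividing it preserves the image (`Taylor.exists_diff_eq`).
-/

namespace GradedRes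

open MvPolynomial

variable {V K : Type*} [Field K]

/-! ### Homogeneous components indexed by the integers -/

/-- The homogeneous component of degree `n` of a polynomial, for an integer `n`; it vanishes for
negative `n`. -/
noncomputable def comp (n : ℤ) : MvPolynomial V K →ₗ[K] MvPolynomial V K :=
  if 0 ≤ n then homogeneousComponent n.toNat else 0

open Classical in
lemma coeff_comp (n : ℤ) (p : MvPolynomial V K) (d : V →₀ ℕ) :
    coeff d (comp n p) = if (d.degree : ℤ) = n then coeff d p else 0 := by
  unfold comp
  by_cases hn : 0 ≤ n
  · rw [if_pos hn, coeff_homogeneousComponent]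
    exact if_congr (by omega) rfl rfl
  · rw [if_neg hn, if_neg (by omega)]
    simp

lemma mem_polyGrading_iff_coeff {n : ℤ} {p : MvPolynomial V K} :
    p ∈ polyGrading V K n ↔ ∀ d, coeff d p ≠ 0 → (d.degree : ℤ) = n := by
  unfold polyGrading
  by_cases hn : 0 ≤ n
  · rw [if_pos hn, mem_homogeneousSubmodule]
    refine forall_congr' fun d => imp_congr_right fun _ => ?_
    have : d.degree = Finsupp.weight (1 : V → ℕ) d :=
      DFunLike.congr_fun Finsupp.degree_eq_weight_one d
    rw [← this]
    omega
  · rw [if_neg hn, Submodule.mem_bot]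
    constructor
    · rintro rfl d hd
      simp at hd
    · intro h
      ext d
      by_contra hd
      have := h d (by simpa using hd)
      omega

lemma mem_polyGrading_iff_comp {n : ℤ} {p : MvPolynomial V K} :
    p ∈ polyGrading V K n ↔ comp n p = p := by
  classical
  rw [mem_polyGrading_iff_coeff, MvPolynomial.ext_iff]
  refine forall_congr' fun d => ?_
  rw [coeff_comp]
  by_cases h : (d.degree : ℤ) = n <;> simp [h, eq_comm]

lemma comp_comp (n : ℤ) (p : MvPolynomial V K) : comp n (comp n p) = comp n p := by
  classical
  ext d
  simp only [coeff_comp]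
  split_ifs <;> rfl

lemma comp_mem (n : ℤ) (p : MvPolynomial V K) : comp n p ∈ polyGrading V K n :=
  mem_polyGrading_iff_comp.2 (comp_comp n p)

lemma comp_mul {n k : ℤ} (p : MvPolynomial V K) {q : MvPolynomial V K} (hq : comp k q = q) :
    comp n (p * q) = comp (n - k) p * q := by
  classical
  rw [← mem_polyGrading_iff_comp, mem_polyGrading_iff_coeff] at hq
  ext d
  rw [coeff_comp, coeff_mul, coeff_mul, ← Finset.sum_const_zero
    (s := Finset.HasAntidiagonal.antidiagonal d), ← Finset.sum_ite_irrel]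
  refine Finset.sum_congr rfl fun x hx => ?_
  rw [coeff_comp]
  by_cases h : coeff x.2 q = 0
  · simp [h]
  · have h1 := hq _ h
    have h2 : x.1.degree + x.2.degree = d.degree := by
      rw [← Finset.HasAntidiagonal.mem_antidiagonal.1 hx, map_add]
    rw [ite_mul, zero_mul]
    exact if_congr (by omega) rfl rfl

lemma comp_zero_eq (p : MvPolynomial V K) : comp 0 p = C (constantCoeff p) := by
  simp [comp, constantCoeff_eq, homogeneousComponent_zero]

lemma sum_comp (p : MvPolynomial V K) :
    ∃ s : Finset ℤ, (∀ n ∉ s, comp n p = 0) ∧ ∑ n ∈ s, comp n p = p := by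
  classical
  refine ⟨p.support.image fun d => (d.degree : ℤ), fun n hn => ?_, ?_⟩
  · ext d
    rw [coeff_comp]
    split_ifs with h
    · by_contra hd
      exact hn (Finset.mem_image.2 ⟨d, by simpa using hd, h⟩)
    · simp
  · ext d
    rw [coeff_sum]
    simp only [coeff_comp, Finset.sum_ite_eq]
    split_ifs with h
    · rfl
    · by_contra hd
      exact h (Finset.mem_image.2 ⟨d, by simpa [eq_comm] using hd, rfl⟩)

lemma constantCoeff_eq_zero_of_mem {n : ℤ} {p : MvPolynomial V K} (hp : p ∈ polyGrading V K n)
    (hn : n ≠ 0) : constantCoeff p = 0 := by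
  by_contra h
  exact hn (by simpa using (mem_polyGrading_iff_coeff.1 hp 0 h).symm)

lemma mem_span_X_iff {p : MvPolynomial V K} :
    p ∈ Ideal.span (Set.range (X : V → MvPolynomial V K)) ↔ constantCoeff p = 0 := by
  rw [← Set.image_univ, mem_ideal_span_X_image]
  constructor
  · intro h
    by_contra h0
    obtain ⟨i, -, hi⟩ := h 0 (by simpa [constantCoeff_eq] using h0)
    simp at hi
  · intro h d hd
    have : d ≠ 0 := by
      rintro rfl
      exact (mem_support_iff.1 hd) h
    obtain ⟨i, hi⟩ := Finsupp.ne_iff.1 this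
    exact ⟨i, trivial, hi⟩

/-! ### Graded modules through their homogeneous components -/

/-- A `ℤ`-grading of a module `M` over the polynomial ring, given by the projections `pr n` of `M`
onto its homogeneous components; an element `m` is homogeneous of degree `k` if `pr k m = m`. -/
structure Components (V K : Type*) [Field K] (M : Type*) [AddCommGroup M]
    [Module (MvPolynomial V K) M] where
  /-- the projection onto the homogeneous component of degree `n` -/
  pr : ℤ → M →+ M
  pr_smul : ∀ (n k : ℤ) (p : MvPolynomial V K) (m : M), pr k m = m →
    pr n (p • m) = comp (n - k) p • m
  pr_pr : ∀ n m, pr n (pr n m) = pr n m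
  sum_pr : ∀ m, ∃ s : Finset ℤ, ∑ n ∈ s, pr n m = m

section Free

variable {ι : Type*} [Fintype ι]

/-- The graded free module `⨁ₗ R(-deg l)`. -/
noncomputable def Components.free (deg : ι → ℤ) : Components V K (ι → MvPolynomial V K) where
  pr n :=
    { toFun := fun v l => comp (n - deg l) (v l)
      map_zero' := by ext1; simp
      map_add' := fun _ _ => by ext1; simp }
  pr_smul n k p m hm := by
    ext1 l
    have := congrFun hm l
    simp only [AddMonoidHom.coe_mk, ZeroHom.coe_mk, Pi.smul_apply, smul_eq_mul] at this ⊢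
    rw [comp_mul p this, show n - deg l - (k - deg l) = n - k by ring]
  pr_pr n m := by
    ext1 l
    exact comp_comp _ _
  sum_pr m := by
    classical
    choose s hs hs' using fun l => sum_comp (m l)
    refine ⟨Finset.univ.biUnion fun l => (s l).image (· + deg l), ?_⟩
    ext1 l
    rw [Finset.sum_apply]
    simp only [AddMonoidHom.coe_mk, ZeroHom.coe_mk]
    conv_rhs => rw [← hs' l]
    rw [← Finset.sum_subset (s₁ := (s l).image (· + deg l))
      (Finset.subset_biUnion_of_mem (fun l => (s l).image (· + deg l)) (Finset.mem_univ l)),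
      Finset.sum_image (by simp)]
    · simp
    · intro n _ hn
      refine hs l _ fun h => hn (Finset.mem_image.2 ⟨_, h, by simp⟩)

lemma Components.free_pr_apply (deg : ι → ℤ) (n : ℤ) (v : ι → MvPolynomial V K) (l : ι) :
    (Components.free deg).pr n v l = comp (n - deg l) (v l) := rfl

lemma Components.free_pr_eq_iff {deg : ι → ℤ} {n : ℤ} {v : ι → MvPolynomial V K} :
    (Components.free deg).pr n v = v ↔ ∀ l, v l ∈ polyGrading V K (n - deg l) := by
  rw [funext_iff]
  exact forall_congr' fun l => mem_polyGrading_iff_comp.symm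

lemma linearMap_apply_eq_sum [DecidableEq ι] {M : Type*} [AddCommGroup M]
    [Module (MvPolynomial V K) M]
    (f : (ι → MvPolynomial V K) →ₗ[MvPolynomial V K] M) (v : ι → MvPolynomial V K) :
    f v = ∑ l, v l • f (Pi.single l 1) := by
  conv_lhs => rw [pi_eq_sum_univ' v]
  simp only [map_sum, map_smul]

/-- A linear map on a graded free module which sends the basis elements to homogeneous elements of
the right degrees commutes with the projections onto the homogeneous components. -/
lemma Components.map_pr [DecidableEq ι] {M : Type*} [AddCommGroup M] [Module (MvPolynomial V K) M]
    (c : Components V K M) (deg : ι → ℤ) (f : (ι → MvPolynomial V K) →ₗ[MvPolynomial V K] M)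
    (hf : ∀ l, c.pr (deg l) (f (Pi.single l 1)) = f (Pi.single l 1)) (n : ℤ)
    (v : ι → MvPolynomial V K) : f ((Components.free deg).pr n v) = c.pr n (f v) := by
  rw [linearMap_apply_eq_sum f v, linearMap_apply_eq_sum, map_sum]
  refine Finset.sum_congr rfl fun l _ => ?_
  rw [c.pr_smul _ _ _ _ (hf l), free_pr_apply]

/-- A homogeneous element in the range of a homogeneous map has a homogeneous preimage. -/
lemma Components.exists_homogeneous_preimage [DecidableEq ι] {M : Type*} [AddCommGroup M]
    [Module (MvPolynomial V K) M]
    (c : Components V K M) (deg : ι → ℤ) (f : (ι → MvPolynomial V K) →ₗ[MvPolynomial V K] M)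
    (hf : ∀ l, c.pr (deg l) (f (Pi.single l 1)) = f (Pi.single l 1)) {n : ℤ} {m : M}
    (hm : c.pr n m = m) (hmf : m ∈ LinearMap.range f) :
    ∃ v, (Components.free deg).pr n v = v ∧ f v = m := by
  obtain ⟨v, rfl⟩ := hmf
  exact ⟨_, Components.pr_pr _ n v, by rw [c.map_pr deg f hf, hm]⟩

end Free

/-- A finitely generated homogeneous submodule `N` of a graded module is the image of a homogeneous
map from a graded free module of finite rank, such that the coefficients of every relation between
the generators lie in the ideal of the variables. Such generators are obtained by taking as few
homogeneous generators as possible. -/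
lemma Components.exists_minimal_generators {M : Type*} [AddCommGroup M]
    [Module (MvPolynomial V K) M] (c : Components V K M) (N : Submodule (MvPolynomial V K) M)
    (hN : N.FG) (hc : ∀ n, ∀ m ∈ N, c.pr n m ∈ N) :
    ∃ (r : ℕ) (deg : Fin r → ℤ) (f : (Fin r → MvPolynomial V K) →ₗ[MvPolynomial V K] M),
      (∀ k, c.pr (deg k) (f (Pi.single k 1)) = f (Pi.single k 1)) ∧ LinearMap.range f = N ∧
      ∀ v, f v = 0 → ∀ k, constantCoeff (v k) = 0 := by
  classical
  let P : ℕ → Prop := fun r => ∃ (deg : Fin r → ℤ) (g : Fin r → M),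
    (∀ k, c.pr (deg k) (g k) = g k) ∧ Submodule.span (MvPolynomial V K) (Set.range g) = N
  have hP : ∃ r, P r := by
    let H : Set M := {m | m ∈ N ∧ ∃ n, c.pr n m = m}
    have hH : Submodule.span (MvPolynomial V K) H = N := by
      refine le_antisymm (Submodule.span_le.2 fun m hm => hm.1) fun m hm => ?_
      obtain ⟨s, hs⟩ := c.sum_pr m
      rw [← hs]
      exact Submodule.sum_mem _ fun n _ =>
        Submodule.subset_span ⟨hc n m hm, n, c.pr_pr n m⟩
    rw [← hH, Submodule.fg_span_iff_fg_span_finset_subset] at hN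
    obtain ⟨S, hSH, hS⟩ := hN
    choose d hd using fun x : S => (hSH x.2).2
    refine ⟨S.card, fun k => d (S.equivFin.symm k), fun k => S.equivFin.symm k,
      fun k => hd _, ?_⟩
    rw [← hH, hS, show (fun k => ((S.equivFin.symm k : S) : M)) = Subtype.val ∘ S.equivFin.symm
      from rfl, Set.range_comp, Equiv.range_eq_univ, Set.image_univ, Subtype.range_coe]
  obtain ⟨deg, g, hg, hgN⟩ := Nat.find_spec hP
  have hmin := fun m hm => Nat.find_min hP (m := m) hm
  generalize Nat.find hP = r at deg g hg hgN hmin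
  refine ⟨r, deg, Fintype.linearCombination (MvPolynomial V K) g, fun k => ?_, ?_, ?_⟩
  · rw [Fintype.linearCombination_apply_single, one_smul, hg]
  · rw [Fintype.range_linearCombination, hgN]
  intro v hv k
  by_contra hk
  obtain ⟨r, rfl⟩ : ∃ r', r = r' + 1 := ⟨r - 1, by have := k.2; omega⟩
  refine hmin r (Nat.lt_succ_self r) ⟨deg ∘ k.succAbove, g ∘ k.succAbove, fun _ => hg _, ?_⟩
  rw [← hgN]
  refine le_antisymm (Submodule.span_mono (Set.range_comp_subset_range _ _))
    (Submodule.span_le.2 ?_)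
  set N' := Submodule.span (MvPolynomial V K) (Set.range (g ∘ k.succAbove)) with hN'
  have hother : ∀ l, l ≠ k → g l ∈ N' := by
    intro l hl
    obtain ⟨l', rfl⟩ := Fin.exists_succAbove_eq hl
    exact Submodule.subset_span ⟨l', rfl⟩
  -- the component of degree `deg k` of the relation has an invertible coefficient at `g k`
  have hrel : ∑ l, comp (deg k - deg l) (v l) • g l = 0 := by
    rw [← map_zero (c.pr (deg k)), ← hv, Fintype.linearCombination_apply, map_sum]
    exact Finset.sum_congr rfl fun l _ => (c.pr_smul _ _ _ _ (hg l)).symm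
  rw [← Finset.add_sum_erase _ _ (Finset.mem_univ k), sub_self, comp_zero_eq] at hrel
  have hmem : (C (constantCoeff (v k)) : MvPolynomial V K) • g k ∈ N' := by
    rw [eq_neg_of_add_eq_zero_left hrel]
    exact N'.neg_mem (Submodule.sum_mem _ fun l hl =>
      N'.smul_mem _ (hother l (Finset.ne_of_mem_erase hl)))
  rintro _ ⟨l, rfl⟩
  by_cases hl : l = k
  · subst hl
    have := N'.smul_mem (C (constantCoeff (v l))⁻¹ : MvPolynomial V K) hmem
    rwa [smul_smul, ← C_mul, inv_mul_cancel₀ hk, C_1, one_smul] at this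
  · exact hother l hl

end GradedRes

namespace GradedRes

open MvPolynomial

variable {V K : Type*} [Field K]

/-- The grading of the quotient of the polynomial ring by a homogeneous ideal. -/
noncomputable def Components.quot (I : Ideal (MvPolynomial V K))
    (hI : ∀ n, ∀ p ∈ I, comp n p ∈ I) : Components V K (MvPolynomial V K ⧸ I) where
  pr n := QuotientAddGroup.map I.toAddSubgroup I.toAddSubgroup (comp n).toAddMonoidHom
    fun p hp => hI n p hp
  pr_smul n k p m hm := by
    obtain ⟨q, rfl⟩ := Ideal.Quotient.mk_surjective m
    rw [← hm]
    exact congrArg (Ideal.Quotient.mk I) (comp_mul p (comp_comp k q))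
  pr_pr n m := by
    obtain ⟨q, rfl⟩ := Ideal.Quotient.mk_surjective m
    exact congrArg (Ideal.Quotient.mk I) (comp_comp n q)
  sum_pr m := by
    obtain ⟨q, rfl⟩ := Ideal.Quotient.mk_surjective m
    obtain ⟨s, -, hs⟩ := sum_comp q
    refine ⟨s, ?_⟩
    conv_rhs => rw [← hs]
    rw [map_sum]
    rfl

lemma Components.quot_pr_eq_iff {I : Ideal (MvPolynomial V K)}
    {hI : ∀ n, ∀ p ∈ I, comp n p ∈ I} {n : ℤ} {m : MvPolynomial V K ⧸ I} :
    (Components.quot I hI).pr n m = m ↔ m ∈ quotGrading I n := by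
  constructor
  · intro h
    obtain ⟨q, rfl⟩ := Ideal.Quotient.mk_surjective m
    exact ⟨comp n q, comp_mem n q, h⟩
  · rintro ⟨q, hq, rfl⟩
    exact congrArg (Ideal.Quotient.mk I) (mem_polyGrading_iff_comp.1 hq)

/-- Dependent choice along the natural numbers. -/
lemma exists_seq_of_forall_exists {α : ℕ → Type*} (q : α 0 → Prop) (p : ∀ i, α i → Prop)
    (r : ∀ i, α i → α (i + 1) → Prop) (h0 : ∃ a, q a ∧ p 0 a)
    (hs : ∀ i a, p i a → ∃ b, p (i + 1) b ∧ r i a b) :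
    ∃ f : ∀ i, α i, q (f 0) ∧ ∀ i, p i (f i) ∧ r i (f i) (f (i + 1)) := by
  obtain ⟨a, ha, hpa⟩ := h0
  choose g hg hr using hs
  let F : ∀ i, {a : α i // p i a} := fun i =>
    Nat.rec (motive := fun i => {a : α i // p i a}) ⟨a, hpa⟩
      (fun i x => ⟨g i x.1 x.2, hg i x.1 x.2⟩) i
  exact ⟨fun i => (F i).1, ha, fun i => ⟨(F i).2, hr i _ (F i).2⟩⟩

/-! ### Existence of minimal resolutions -/

/-- A graded free module of finite rank together with a submodule, which stands for the kernel of
the differential in the inductive construction of a minimal resolution. -/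
structure SyzygyStage (V K : Type*) [Field K] where
  /-- the rank of the free module -/
  rank : ℕ
  /-- the degrees of the basis elements -/
  deg : Fin rank → ℤ
  /-- the submodule that remains to be resolved -/
  ker : Submodule (MvPolynomial V K) (Fin rank → MvPolynomial V K)

/-- The kernel of a homogeneous map between graded modules is homogeneous. -/
lemma Components.pr_mem_ker {M : Type*} [AddCommGroup M] [Module (MvPolynomial V K) M]
    (c : Components V K M) {r : ℕ} (deg : Fin r → ℤ)
    (f : (Fin r → MvPolynomial V K) →ₗ[MvPolynomial V K] M)
    (hf : ∀ l, c.pr (deg l) (f (Pi.single l 1)) = f (Pi.single l 1)) (n : ℤ)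
    (v : Fin r → MvPolynomial V K) (hv : v ∈ LinearMap.ker f) :
    (Components.free deg).pr n v ∈ LinearMap.ker f := by
  rw [LinearMap.mem_ker] at *
  rw [c.map_pr deg f hf, hv, map_zero]

lemma nonempty_minimalResolution [Finite V] (I : Ideal (MvPolynomial V K))
    (hI : ∀ n, ∀ p ∈ I, comp n p ∈ I) :
    Nonempty (MinimalResolution (V := V) (quotGrading I)) := by
  classical
  obtain ⟨r₀, deg₀, aug, haug, hrange, hmin₀⟩ :=
    (Components.quot I hI).exists_minimal_generators ⊤ Module.Finite.fg_top fun _ _ _ => trivial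
  obtain ⟨s, hs0, hs⟩ := exists_seq_of_forall_exists (α := fun _ => SyzygyStage V K)
    (fun s => s = ⟨r₀, deg₀, LinearMap.ker aug⟩)
    (fun _ s => (∀ n, ∀ v ∈ s.ker, (Components.free s.deg).pr n v ∈ s.ker) ∧
      ∀ v ∈ s.ker, ∀ k, constantCoeff (v k) = 0)
    (fun _ s s' => ∃ d : (Fin s'.rank → MvPolynomial V K) →ₗ[MvPolynomial V K]
        (Fin s.rank → MvPolynomial V K),
      (∀ k, (Components.free s.deg).pr (s'.deg k) (d (Pi.single k 1)) = d (Pi.single k 1)) ∧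
        LinearMap.range d = s.ker ∧ LinearMap.ker d = s'.ker)
    ⟨_, rfl, (Components.quot I hI).pr_mem_ker deg₀ aug haug, hmin₀⟩ (by
      rintro - s ⟨hs1, -⟩
      obtain ⟨r, deg, d, hd, hdr, hdm⟩ :=
        (Components.free s.deg).exists_minimal_generators s.ker (IsNoetherian.noetherian _) hs1
      exact ⟨⟨r, deg, LinearMap.ker d⟩, ⟨(Components.free s.deg).pr_mem_ker deg d hd, hdm⟩,
        d, hd, hdr, rfl⟩)
  choose hp d hd hdr hdk using hs
  have hd' : ∀ i k, d i k ∈ (s i).ker := fun i k => hdr i ▸ LinearMap.mem_range_self _ _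
  obtain ⟨aug', haug', hsurj, hker⟩ : ∃ aug' : (Fin (s 0).rank → MvPolynomial V K)
      →ₗ[MvPolynomial V K] MvPolynomial V K ⧸ I,
      (∀ k, (Components.quot I hI).pr ((s 0).deg k) (aug' (Pi.single k 1)) =
        aug' (Pi.single k 1)) ∧ LinearMap.range aug' = ⊤ ∧ LinearMap.ker aug' = (s 0).ker := by
    rw [hs0]
    exact ⟨aug, haug, hrange, rfl⟩
  exact ⟨{
    rank := fun i => (s i).rank
    deg := fun i => (s i).deg
    d := d
    aug := aug'
    aug_surjective := LinearMap.range_eq_top.1 hsurj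
    exact_zero := LinearMap.exact_iff.2 (by rw [hker, hdr])
    exact_succ := fun i => LinearMap.exact_iff.2 (by rw [hdk, hdr])
    aug_mem := fun k => Components.quot_pr_eq_iff.1 (haug' k)
    d_mem := fun i k => Components.free_pr_eq_iff.1 (hd i k)
    minimal := fun i k l => mem_span_X_iff.2 ((hp i).2 _ (hd' i _) l) }⟩

/-! ### Comparison of graded free resolutions -/

/-- A graded free resolution of a graded module by free modules of finite rank, not necessarily
minimal; the `i`-th free module has a basis indexed by `ι i`. -/
structure FreeResolution {M : Type*} [AddCommGroup M] [Module (MvPolynomial V K) M]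
    (c : Components V K M) where
  /-- the index types of the bases -/
  ι : ℕ → Type
  [fintype : ∀ i, Fintype (ι i)]
  [decEq : ∀ i, DecidableEq (ι i)]
  /-- the degrees of the basis elements -/
  deg : ∀ i, ι i → ℤ
  /-- the differentials -/
  d : ∀ i, (ι (i + 1) → MvPolynomial V K) →ₗ[MvPolynomial V K] (ι i → MvPolynomial V K)
  /-- the augmentation -/
  aug : (ι 0 → MvPolynomial V K) →ₗ[MvPolynomial V K] M
  aug_surjective : Function.Surjective aug
  exact_zero : Function.Exact (d 0) aug
  exact_succ : ∀ i, Function.Exact (d (i + 1)) (d i)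
  pr_aug : ∀ k, c.pr (deg 0 k) (aug (Pi.single k 1)) = aug (Pi.single k 1)
  pr_d : ∀ i k, (Components.free (deg i)).pr (deg (i + 1) k) (d i (Pi.single k 1)) =
    d i (Pi.single k 1)

namespace FreeResolution

attribute [instance] fintype decEq

variable {M : Type*} [AddCommGroup M] [Module (MvPolynomial V K) M] {c : Components V K M}

lemma d_d (P : FreeResolution c) (i : ℕ) (v) : P.d i (P.d (i + 1) v) = 0 :=
  (P.exact_succ i _).2 ⟨v, rfl⟩

/-- A minimal graded free resolution as a graded free resolution. -/
noncomputable def ofMinimalResolution {I : Ideal (MvPolynomial V K)}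
    {hI : ∀ n, ∀ p ∈ I, comp n p ∈ I} (F : MinimalResolution (V := V) (quotGrading I)) :
    FreeResolution (Components.quot I hI) where
  ι i := Fin (F.rank i)
  deg := F.deg
  d := F.d
  aug := F.aug
  aug_surjective := F.aug_surjective
  exact_zero := F.exact_zero
  exact_succ := F.exact_succ
  pr_aug k := Components.quot_pr_eq_iff.2 (F.aug_mem k)
  pr_d i k := Components.free_pr_eq_iff.2 (F.d_mem i k)

/-- A linear map out of a free module can be lifted along a map whose range contains its range. -/
lemma exists_lift {ι R M N : Type*} [Fintype ι] [CommRing R] [AddCommGroup M] [Module R M]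
    [AddCommGroup N] [Module R N] (f : (ι → R) →ₗ[R] N) (g : M →ₗ[R] N)
    (h : ∀ v, f v ∈ LinearMap.range g) : ∃ φ : (ι → R) →ₗ[R] M, ∀ v, g (φ v) = f v := by
  classical
  choose w hw using fun k => h (Pi.single k 1)
  refine ⟨Fintype.linearCombination R w, fun v => ?_⟩
  rw [← LinearMap.comp_apply]
  congr 1
  refine LinearMap.pi_ext' fun k => LinearMap.ext_ring ?_
  simp [Fintype.linearCombination_apply_single, hw]

/-- A homogeneous linear map out of a graded free module can be lifted along a homogeneous map
to a homogeneous map. -/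
lemma exists_homogeneous_lift {ι κ N : Type*} [Fintype ι] [DecidableEq ι] [Fintype κ]
    [DecidableEq κ] [AddCommGroup N] [Module (MvPolynomial V K) N] (cN : Components V K N)
    (deg : ι → ℤ) (deg' : κ → ℤ) (f : (ι → MvPolynomial V K) →ₗ[MvPolynomial V K] N)
    (g : (κ → MvPolynomial V K) →ₗ[MvPolynomial V K] N)
    (hf : ∀ k, cN.pr (deg k) (f (Pi.single k 1)) = f (Pi.single k 1))
    (hg : ∀ k, cN.pr (deg' k) (g (Pi.single k 1)) = g (Pi.single k 1))
    (h : ∀ v, f v ∈ LinearMap.range g) :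
    ∃ φ : (ι → MvPolynomial V K) →ₗ[MvPolynomial V K] (κ → MvPolynomial V K),
      (∀ k, (Components.free deg').pr (deg k) (φ (Pi.single k 1)) = φ (Pi.single k 1)) ∧
        ∀ v, g (φ v) = f v := by
  choose w hw hw' using fun k =>
    cN.exists_homogeneous_preimage deg' g hg (hf k) (h (Pi.single k 1))
  refine ⟨Fintype.linearCombination _ w, fun k => ?_, fun v => ?_⟩
  · rw [Fintype.linearCombination_apply_single, one_smul, hw]
  rw [← LinearMap.comp_apply]
  congr 1
  refine LinearMap.pi_ext' fun k => LinearMap.ext_ring ?_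
  simp [Fintype.linearCombination_apply_single, hw']

/-- Any two graded free resolutions of a module are related by a homogeneous chain map over the
identity. The inductive step only needs that the last map sends boundaries to boundaries. -/
lemma exists_chainMap (P Q : FreeResolution c) :
    ∃ φ : ∀ i, (P.ι i → MvPolynomial V K) →ₗ[MvPolynomial V K] (Q.ι i → MvPolynomial V K),
      (∀ i k, (Components.free (Q.deg i)).pr (P.deg i k) (φ i (Pi.single k 1)) =
        φ i (Pi.single k 1)) ∧
      (∀ v, Q.aug (φ 0 v) = P.aug v) ∧ ∀ i v, Q.d i (φ (i + 1) v) = φ i (P.d i v) := by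
  obtain ⟨φ, h0, h⟩ := exists_seq_of_forall_exists
    (α := fun i => (P.ι i → MvPolynomial V K) →ₗ[MvPolynomial V K] (Q.ι i → MvPolynomial V K))
    (fun φ => ∀ v, Q.aug (φ v) = P.aug v)
    (fun i φ => (∀ k, (Components.free (Q.deg i)).pr (P.deg i k) (φ (Pi.single k 1)) =
        φ (Pi.single k 1)) ∧ ∀ v, φ (P.d i v) ∈ LinearMap.range (Q.d i))
    (fun i φ φ' => ∀ v, Q.d i (φ' v) = φ (P.d i v))
    (by
      obtain ⟨φ, h1, h2⟩ := exists_homogeneous_lift c (P.deg 0) (Q.deg 0) P.aug Q.aug P.pr_aug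
        Q.pr_aug fun v => Q.aug_surjective _
      exact ⟨φ, h2, h1, fun v => (Q.exact_zero _).1 (by
        rw [h2]
        exact (P.exact_zero _).2 ⟨v, rfl⟩)⟩)
    (by
      rintro i φ ⟨h1, h2⟩
      obtain ⟨φ', h1', h2'⟩ := exists_homogeneous_lift (Components.free (Q.deg i)) (P.deg (i + 1))
        (Q.deg (i + 1)) (φ ∘ₗ P.d i) (Q.d i) (fun k => by
          rw [LinearMap.comp_apply,
            ← (Components.free (Q.deg i)).map_pr (P.deg i) φ h1, P.pr_d]) (Q.pr_d i) h2
      exact ⟨φ', ⟨h1', fun v => (Q.exact_succ i _).1 (by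
        rw [h2', LinearMap.comp_apply, P.d_d, map_zero])⟩, h2'⟩)
  exact ⟨φ, fun i => (h i).1.1, h0, fun i => (h i).2⟩

/-- A chain endomorphism of a resolution which lifts the zero map is null-homotopic. -/
lemma exists_homotopy (P : FreeResolution c)
    (θ : ∀ i, (P.ι i → MvPolynomial V K) →ₗ[MvPolynomial V K] (P.ι i → MvPolynomial V K))
    (hθ0 : ∀ v, P.aug (θ 0 v) = 0) (hθ : ∀ i v, P.d i (θ (i + 1) v) = θ i (P.d i v)) :
    ∃ h : ∀ i, (P.ι i → MvPolynomial V K) →ₗ[MvPolynomial V K] (P.ι (i + 1) → MvPolynomial V K),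
      (∀ v, θ 0 v = P.d 0 (h 0 v)) ∧
      ∀ i v, θ (i + 1) v = P.d (i + 1) (h (i + 1) v) + h i (P.d i v) := by
  obtain ⟨h, h0, hh⟩ := exists_seq_of_forall_exists
    (α := fun i => (P.ι i → MvPolynomial V K) →ₗ[MvPolynomial V K]
      (P.ι (i + 1) → MvPolynomial V K))
    (fun h => ∀ v, P.d 0 (h v) = θ 0 v)
    (fun i h => ∀ v, (θ (i + 1) - h ∘ₗ P.d i) v ∈ LinearMap.range (P.d (i + 1)))
    (fun i h h' => ∀ v, P.d (i + 1) (h' v) = (θ (i + 1) - h ∘ₗ P.d i) v)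
    (by
      obtain ⟨h, hh⟩ := exists_lift (θ 0) (P.d 0) fun v => (P.exact_zero _).1 (hθ0 v)
      exact ⟨h, hh, fun v => (P.exact_succ 0 _).1 (by simp [hh, hθ])⟩)
    (by
      intro i h hh
      obtain ⟨h', hh'⟩ := exists_lift _ _ hh
      exact ⟨h', fun v => (P.exact_succ (i + 1) _).1 (by simp [hh', hθ, P.d_d]), hh'⟩)
  exact ⟨h, fun v => (h0 v).symm, fun i v => by simp [(hh i).2 v]⟩

/-- A basis element is minimal if its coefficient in every boundary and all coefficients of its
own boundary have constant term zero. It then contributes to every graded free resolution. -/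
def IsMinimalAt (P : FreeResolution c) : (i : ℕ) → P.ι i → Prop
  | 0, e => ∀ v, constantCoeff (P.d 0 v e) = 0
  | i + 1, e => (∀ v, constantCoeff (P.d (i + 1) v e) = 0) ∧
      ∀ l, constantCoeff (P.d i (Pi.single e 1) l) = 0

/-- The degree of a minimal basis element of a graded free resolution occurs, in the same
homological degree, in every graded free resolution of the module: modulo the variables,
the composition of comparison maps there and back fixes the coefficient of that element. -/
theorem IsMinimalAt.exists_deg_eq {P : FreeResolution c} {i : ℕ} {e : P.ι i}
    (he : P.IsMinimalAt i e) (Q : FreeResolution c) : ∃ l, Q.deg i l = P.deg i e := by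
  obtain ⟨φ, hφ, hφ0, hφd⟩ := exists_chainMap P Q
  obtain ⟨ψ, -, hψ0, hψd⟩ := exists_chainMap Q P
  obtain ⟨h, h0, hs⟩ := exists_homotopy P (fun i => ψ i ∘ₗ φ i - LinearMap.id)
    (fun v => by simp [hψ0, hφ0]) (fun i v => by simp [hψd, hφd])
  have hθ : constantCoeff ((ψ i (φ i (Pi.single e 1)) - Pi.single e 1 : P.ι i → _) e) = 0 := by
    cases i with
    | zero =>
      have := h0 (Pi.single e 1)
      simp only [LinearMap.sub_apply, LinearMap.comp_apply, LinearMap.id_apply] at this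
      rw [this]
      exact he _
    | succ i =>
      have := hs i (Pi.single e 1)
      simp only [LinearMap.sub_apply, LinearMap.comp_apply, LinearMap.id_apply] at this
      rw [this, Pi.add_apply, map_add, he.1, zero_add, linearMap_apply_eq_sum, Finset.sum_apply,
        map_sum]
      exact Finset.sum_eq_zero fun l _ => by
        rw [Pi.smul_apply, smul_eq_mul, map_mul, he.2, zero_mul]
  rw [Pi.sub_apply, Pi.single_eq_same, map_sub, map_one, sub_eq_zero, linearMap_apply_eq_sum,
    Finset.sum_apply, map_sum] at hθ
  obtain ⟨l, -, hl⟩ := Finset.exists_ne_zero_of_sum_ne_zero (hθ.trans_ne one_ne_zero)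
  rw [Pi.smul_apply, smul_eq_mul, map_mul] at hl
  refine ⟨l, ?_⟩
  by_contra hne
  exact left_ne_zero_of_mul hl (constantCoeff_eq_zero_of_mem
    (Components.free_pr_eq_iff.1 (hφ i e) l) (sub_ne_zero.2 (Ne.symm hne)))

lemma isMinimalAt_ofMinimalResolution {I : Ideal (MvPolynomial V K)}
    {hI : ∀ n, ∀ p ∈ I, comp n p ∈ I} (F : MinimalResolution (V := V) (quotGrading I)) (i : ℕ)
    (e : Fin (F.rank i)) : (ofMinimalResolution (hI := hI) F).IsMinimalAt i e := by
  have h1 : ∀ i v (e : Fin (F.rank i)), constantCoeff (F.d i v e) = 0 := by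
    intro i v e
    rw [linearMap_apply_eq_sum, Finset.sum_apply, map_sum]
    exact Finset.sum_eq_zero fun l _ => by
      rw [Pi.smul_apply, smul_eq_mul, map_mul, mem_span_X_iff.1 (F.minimal i l e), mul_zero]
  cases i with
  | zero => exact fun v => h1 0 v e
  | succ i => exact ⟨fun v => h1 (i + 1) v e, fun l => h1 i _ l⟩

/-- The regularity can be read off from any graded free resolution, if the largest difference
between the degree of a basis element and its homological degree is attained at a minimal
basis element. -/
theorem isRegularityQuot [Finite V] {I : Ideal (MvPolynomial V K)}
    {hI : ∀ n, ∀ p ∈ I, comp n p ∈ I} (P : FreeResolution (Components.quot I hI)) (N : ℤ)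
    (hN : ∀ i e, P.deg i e ≤ i + N) {i : ℕ} {e : P.ι i} (he : P.IsMinimalAt i e)
    (hie : P.deg i e = i + N) : IsRegularityQuot I N := by
  refine ⟨nonempty_minimalResolution I hI, fun F => ⟨?_, ?_⟩⟩
  · obtain ⟨l, hl⟩ := he.exists_deg_eq (ofMinimalResolution F)
    exact ⟨i, i + N, Finset.card_ne_zero_of_mem
      (Finset.mem_filter.2 ⟨Finset.mem_univ l, hl.trans hie⟩), by ring⟩
  · rintro _ ⟨i, j, hij, rfl⟩
    obtain ⟨k, hk⟩ := Finset.card_ne_zero.1 hij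
    obtain ⟨l, hl⟩ := (isMinimalAt_ofMinimalResolution (hI := hI) F i k).exists_deg_eq P
    have := hN i l
    rw [hl] at this
    rw [← (Finset.mem_filter.1 hk).2]
    change F.deg i k ≤ _ at this
    omega

end FreeResolution

end GradedRes

/-! ### The chain complex of a simplex -/

namespace SimplexChain

section Sign

variable {ι : Type*} [LinearOrder ι]

/-- The sign with which the face `S` occurs in the boundary of `insert k S`, for `k ∉ S`. -/
def faceSign (k : ι) (S : Finset ι) : ℤ := (-1) ^ (S.filter (· < k)).card

lemma faceSign_mul_self (k : ι) (S : Finset ι) : faceSign k S * faceSign k S = 1 := by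
  rw [faceSign, ← mul_pow]
  simp

lemma faceSign_insert_of_lt {k l : ι} {S : Finset ι} (hkl : k < l) (hk : k ∉ S) :
    faceSign l (insert k S) = -faceSign l S := by
  rw [faceSign, faceSign, Finset.filter_insert, if_pos hkl,
    Finset.card_insert_of_notMem (by simp [hk]), pow_succ]
  ring

lemma faceSign_insert_of_not_lt {k l : ι} {S : Finset ι} (hkl : ¬k < l) :
    faceSign l (insert k S) = faceSign l S := by
  rw [faceSign, faceSign, Finset.filter_insert, if_neg hkl]

lemma faceSign_insert_mul_faceSign_insert {k l : ι} {S : Finset ι} (hkl : k ≠ l) (hk : k ∉ S)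
    (hl : l ∉ S) : faceSign l (insert k S) * faceSign k (insert l S) +
      faceSign k S * faceSign l S = 0 := by
  rcases lt_or_gt_of_ne hkl with h | h
  · rw [faceSign_insert_of_lt h hk, faceSign_insert_of_not_lt h.not_gt]
    ring
  · rw [faceSign_insert_of_lt h hl, faceSign_insert_of_not_lt h.not_gt]
    ring

end Sign

variable {ι A : Type*} [Fintype ι] [LinearOrder ι] [AddCommGroup A]

/-- The boundary operator of the augmented chain complex, with coefficients in `A`, of the simplex
with vertex set `ι`; a chain is a function on all faces, of whatever dimension. -/
def bd (w : Finset ι → A) (S : Finset ι) : A := ∑ k ∈ Sᶜ, faceSign k S • w (insert k S)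

/-- The join with the vertex `k`, a contracting homotopy of the simplex. -/
def cone (k : ι) (w : Finset ι → A) (T : Finset ι) : A :=
  if k ∈ T then faceSign k (T.erase k) • w (T.erase k) else 0

lemma bd_sum {κ : Type*} (s : Finset κ) (w : κ → Finset ι → A) (S : Finset ι) :
    bd (fun T => ∑ k ∈ s, w k T) S = ∑ k ∈ s, bd (w k) S := by
  simp only [bd, Finset.smul_sum]
  rw [Finset.sum_comm]

lemma bd_map {B : Type*} [AddCommGroup B] (f : A →+ B) (w : Finset ι → A) (S : Finset ι) :
    bd (fun T => f (w T)) S = f (bd w S) := by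
  simp only [bd, map_sum, map_zsmul]

/-- The join with `k` contracts the simplex. If `k ∈ S`, the term `l = k` of the boundary gives
`w S` and the others cancel in pairs; if `k ∉ S`, only the term for `k` is left. -/
lemma bd_cone_add_cone_bd (k : ι) (w : Finset ι → A) (S : Finset ι) :
    bd (cone k w) S + cone k (bd w) S = w S := by
  by_cases hk : k ∈ S
  · obtain ⟨S, hkS, rfl⟩ : ∃ S', k ∉ S' ∧ S = insert k S' :=
      ⟨S.erase k, Finset.notMem_erase k S, (Finset.insert_erase hk).symm⟩
    rw [cone, if_pos hk, Finset.erase_insert hkS, bd, bd,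
      show Sᶜ = insert k (insert k S)ᶜ by
        ext x
        by_cases hx : x = k <;> simp [hx, hkS],
      Finset.sum_insert (by simp), smul_add, smul_smul, faceSign_mul_self, one_smul,
      add_comm (w _), ← add_assoc, Finset.smul_sum, ← Finset.sum_add_distrib,
      Finset.sum_eq_zero, zero_add]
    intro l hl
    simp only [Finset.mem_compl, Finset.mem_insert, not_or] at hl
    rw [cone, if_pos (by simp), Finset.insert_comm,
      Finset.erase_insert (by simp [hkS, Ne.symm hl.1]),
      smul_smul, smul_smul, ← add_smul,
      faceSign_insert_mul_faceSign_insert (Ne.symm hl.1) hkS hl.2, zero_smul]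
  · rw [cone, if_neg hk, add_zero, bd, Finset.sum_eq_single k]
    · rw [cone, if_pos (by simp), Finset.erase_insert hk, smul_smul, faceSign_mul_self, one_smul]
    · intro l _ hl
      rw [cone, if_neg (by simp [hk, Ne.symm hl]), smul_zero]
    · simp [hk]

/-- The square of the boundary vanishes. It commutes with every join, so that its value at a face
is determined by that at larger faces. -/
lemma bd_bd (w : Finset ι → A) (S : Finset ι) : bd (bd w) S = 0 := by
  induction h : Sᶜ.card generalizing w S with
  | zero =>
    rw [Finset.card_eq_zero] at h
    rw [bd, h, Finset.sum_empty]
  | succ n ih =>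
    -- compare the values at `insert k S`, where the induction hypothesis applies to `cone k w`
    obtain ⟨k, hk⟩ : Sᶜ.Nonempty := Finset.card_pos.1 (by omega)
    have hk' : k ∉ S := Finset.mem_compl.1 hk
    have hsub : ∀ (a b : Finset ι → A) (T : Finset ι),
        bd (fun U => a U - b U) T = bd a T - bd b T := by
      intro a b T
      simp only [bd, smul_sub, Finset.sum_sub_distrib]
    have h1 : bd (cone k w) = fun T => w T - cone k (bd w) T := by
      ext T
      rw [← bd_cone_add_cone_bd k w T, add_sub_cancel_right]
    have h2 : bd (bd (cone k w)) (insert k S) = cone k (bd (bd w)) (insert k S) := by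
      rw [h1, hsub, ← bd_cone_add_cone_bd k (bd w) (insert k S), add_sub_cancel_left]
    rw [ih (cone k w) (insert k S) (by
      rw [Finset.compl_insert, Finset.card_erase_of_mem hk]; omega), cone,
      if_pos (Finset.mem_insert_self k S), Finset.erase_insert hk'] at h2
    have h3 := congrArg (faceSign k S • ·) h2
    simp only [smul_zero, smul_smul, faceSign_mul_self, one_smul] at h3
    exact h3.symm

end SimplexChain

/-! ### The Taylor resolution -/

namespace Taylor

open MvPolynomial SimplexChain GradedRes

variable {V K : Type*} [Field K]

open Classical in
lemma coeff_sum_filter_support (P : Set (V →₀ ℕ)) (p : MvPolynomial V K) (d : V →₀ ℕ) :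
    coeff d (∑ b ∈ p.support with b ∈ P, monomial b (coeff b p)) =
      if d ∈ P then coeff d p else 0 := by
  simp only [coeff_sum, coeff_monomial, Finset.sum_ite_eq', Finset.mem_filter,
    mem_support_iff]
  by_cases h1 : coeff d p = 0 <;> simp [h1]

open Classical in
/-- The additive operator on polynomials which keeps the monomials with exponent in `P`. -/
noncomputable def restrict (P : Set (V →₀ ℕ)) : MvPolynomial V K →+ MvPolynomial V K where
  toFun p := ∑ b ∈ p.support with b ∈ P, monomial b (coeff b p)
  map_zero' := by simp
  map_add' p q := by
    ext d
    rw [coeff_add, coeff_sum_filter_support, coeff_sum_filter_support, coeff_sum_filter_support]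
    split_ifs <;> simp

open Classical in
lemma coeff_restrict (P : Set (V →₀ ℕ)) (p : MvPolynomial V K) (d : V →₀ ℕ) :
    coeff d (restrict P p) = if d ∈ P then coeff d p else 0 :=
  coeff_sum_filter_support P p d

lemma monomial_one_dvd_iff {a : V →₀ ℕ} {p : MvPolynomial V K} :
    monomial a 1 ∣ p ↔ ∀ b, coeff b p ≠ 0 → a ≤ b := by
  rw [← Ideal.mem_span_singleton, ← Set.image_singleton (f := fun s => monomial s (1 : K)),
    mem_ideal_span_monomial_image]
  simp

variable {n : ℕ} (g : Fin n → V →₀ ℕ)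

/-- The ideal generated by the monomials with exponents `g k`. -/
noncomputable def monomialIdeal (K : Type*) [Field K] : Ideal (MvPolynomial V K) :=
  Ideal.span (Set.range fun k => monomial (g k) (1 : K))

lemma mem_monomialIdeal_iff {p : MvPolynomial V K} :
    p ∈ monomialIdeal g K ↔ ∀ b, coeff b p ≠ 0 → ∃ k, g k ≤ b := by
  rw [monomialIdeal, Set.range_comp' (fun s => monomial s (1 : K)) g, mem_ideal_span_monomial_image]
  simp

lemma comp_mem_monomialIdeal (m : ℤ) (p : MvPolynomial V K) (hp : p ∈ monomialIdeal g K) :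
    comp m p ∈ monomialIdeal g K := by
  classical
  rw [mem_monomialIdeal_iff] at *
  intro b hb
  rw [coeff_comp] at hb
  exact hp b (ite_ne_right_iff.1 hb).2

/-- The exponent of the least common multiple of the generators indexed by `T`. -/
noncomputable def lcmExp (T : Finset (Fin n)) : V →₀ ℕ := T.sup g

lemma lcmExp_mono {S T : Finset (Fin n)} (h : S ⊆ T) : lcmExp g S ≤ lcmExp g T :=
  Finset.sup_mono h

lemma lcmExp_insert (k : Fin n) (S : Finset (Fin n)) :
    lcmExp g (insert k S) = g k ⊔ lcmExp g S := Finset.sup_insert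

/-- The exponents of the monomials in the ideal for which the `k`-th generator is the chosen one
among the generators dividing the monomial. -/
def chosenSet (k : Fin n) : Set (V →₀ ℕ) := {b | g k ≤ b ∧ ∀ l < k, ¬g l ≤ b}

lemma sum_restrict_chosenSet {p : MvPolynomial V K} (hp : p ∈ monomialIdeal g K) :
    ∑ k, restrict (chosenSet g k) p = p := by
  classical
  ext b
  rw [coeff_sum]
  simp only [coeff_restrict]
  by_cases hb : coeff b p = 0
  · simp [hb]
  obtain ⟨k, hk, hmin⟩ : ∃ k, g k ≤ b ∧ ∀ l < k, ¬g l ≤ b := by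
    obtain ⟨k, hk, hmin⟩ := exists_minimal_of_wellFoundedLT (fun k => g k ≤ b)
      ((mem_monomialIdeal_iff g).1 hp b hb)
    exact ⟨k, hk, fun l hl h => absurd (hmin h hl.le) (not_le.2 hl)⟩
  rw [Finset.sum_eq_single k, if_pos ⟨hk, hmin⟩]
  · intro l _ hl
    rw [if_neg]
    rintro ⟨h1, h2⟩
    rcases lt_or_gt_of_ne hl with h | h
    · exact hmin l h h1
    · exact h2 k h hk
  · simp

/-- The faces of dimension `i - 1` of the simplex on the generators. -/
abbrev Face (n i : ℕ) : Type := {T : Finset (Fin n) // T.card = i}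

/-- Extension by zero from the faces with `i` vertices to all faces. -/
noncomputable def extend (i : ℕ) :
    (Face n i → MvPolynomial V K) →ₗ[MvPolynomial V K] (Finset (Fin n) → MvPolynomial V K) where
  toFun v T := if h : T.card = i then v ⟨T, h⟩ else 0
  map_add' v w := by
    ext1 T
    by_cases h : T.card = i <;> simp [h]
  map_smul' r v := by
    ext1 T
    by_cases h : T.card = i <;> simp [h]

lemma extend_apply {i : ℕ} (v : Face n i → MvPolynomial V K) (T : Face n i) :
    extend i v T.1 = v T := dif_pos T.2

lemma extend_of_card_ne {i : ℕ} (v : Face n i → MvPolynomial V K) {T : Finset (Fin n)}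
    (hT : T.card ≠ i) : extend i v T = 0 := dif_neg hT

/-- The differential of the Taylor complex: the coefficient at the face `S` of the boundary. -/
noncomputable def diff (i : ℕ) :
    (Face n (i + 1) → MvPolynomial V K) →ₗ[MvPolynomial V K] (Face n i → MvPolynomial V K) where
  toFun v S := ∑ k ∈ S.1ᶜ, faceSign k S.1 •
    (monomial (lcmExp g (insert k S.1) - lcmExp g S.1) 1 * extend (i + 1) v (insert k S.1))
  map_add' v w := by
    ext1 S
    simp [mul_add, Finset.sum_add_distrib]
  map_smul' r v := by
    ext1 S
    simp only [map_smul, Pi.smul_apply, smul_eq_mul, RingHom.id_apply, Finset.mul_sum]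
    refine Finset.sum_congr rfl fun k _ => ?_
    rw [mul_smul_comm]
    ring_nf

lemma diff_apply (i : ℕ) (v : Face n (i + 1) → MvPolynomial V K) (S : Face n i) :
    diff g i v S = ∑ k ∈ S.1ᶜ, faceSign k S.1 •
      (monomial (lcmExp g (insert k S.1) - lcmExp g S.1) 1 * extend (i + 1) v (insert k S.1)) := rfl

/-- The embedding of the Taylor complex into the chain complex of the simplex with coefficients in
the polynomial ring, multiplication by the least common multiple of the generators at each face. -/
noncomputable def embed (i : ℕ) (v : Face n i → MvPolynomial V K) (T : Finset (Fin n)) :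
    MvPolynomial V K := monomial (lcmExp g T) 1 * extend i v T

lemma embed_injective (i : ℕ) :
    Function.Injective (embed g i : (Face n i → MvPolynomial V K) → _) := by
  intro v w h
  ext1 T
  have := congrFun h T.1
  rw [embed, embed, extend_apply, extend_apply] at this
  exact mul_left_cancel₀ (by simp) this

lemma bd_embed (i : ℕ) (v : Face n (i + 1) → MvPolynomial V K) :
    bd (embed g (i + 1) v) = embed g i (diff g i v) := by
  ext1 S
  by_cases hS : S.card = i
  · rw [embed, extend_apply _ ⟨S, hS⟩, diff_apply, bd, Finset.mul_sum]
    refine Finset.sum_congr rfl fun k _ => ?_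
    rw [mul_smul_comm, embed, ← mul_assoc, monomial_mul, one_mul,
      add_tsub_cancel_of_le (lcmExp_mono g (Finset.subset_insert k S))]
  · rw [embed, extend_of_card_ne _ hS, mul_zero, bd]
    refine Finset.sum_eq_zero fun k hk => ?_
    rw [embed, extend_of_card_ne, mul_zero, smul_zero]
    rw [Finset.card_insert_of_notMem (Finset.mem_compl.1 hk)]
    omega

lemma bd_embed_zero (v : Face n 0 → MvPolynomial V K) : bd (embed g 0 v) = 0 := by
  ext1 S
  refine Finset.sum_eq_zero fun k _ => ?_
  rw [embed, extend_of_card_ne, mul_zero, smul_zero]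
  simp

/-- A chain lies in the Taylor complex if its coefficient at each face is divisible by the least
common multiple of the generators. -/
lemma exists_embed_eq {i : ℕ} {w : Finset (Fin n) → MvPolynomial V K}
    (h1 : ∀ T, T.card ≠ i → w T = 0) (h2 : ∀ T, monomial (lcmExp g T) 1 ∣ w T) :
    ∃ v, embed g i v = w := by
  choose u hu using h2
  refine ⟨fun T => u T.1, ?_⟩
  ext1 T
  by_cases hT : T.card = i
  · rw [embed, extend_apply _ ⟨T, hT⟩, hu]
  · rw [embed, extend_of_card_ne _ hT, h1 T hT, mul_zero]

/-- A cycle of the Taylor complex with coefficients in the ideal is a boundary: each monomial of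
the coefficients is joined with a generator that divides it. -/
lemma exists_diff_eq {i : ℕ} {v : Face n i → MvPolynomial V K} (hv : bd (embed g i v) = 0)
    (hI : ∀ T, embed g i v T ∈ monomialIdeal g K) : ∃ u, diff g i u = v := by
  classical
  set w := embed g i v with hw
  obtain ⟨u, hu⟩ := exists_embed_eq g (i := i + 1)
    (w := fun T => ∑ k, cone k (fun S => restrict (chosenSet g k) (w S)) T)
    (fun T hT => Finset.sum_eq_zero fun k _ => by
      rw [cone]
      split_ifs with hk
      · rw [hw, embed, extend_of_card_ne, mul_zero, map_zero, smul_zero]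
        rw [Finset.card_erase_of_mem hk]
        have := Finset.card_pos.2 ⟨k, hk⟩
        omega
      · rfl)
    (fun T => Finset.dvd_sum fun k _ => by
      rw [cone]
      split_ifs with hk
      · rw [zsmul_eq_mul]
        refine Dvd.dvd.mul_left ?_ _
        rw [monomial_one_dvd_iff]
        intro b hb
        rw [coeff_restrict] at hb
        obtain ⟨hb1, hb2⟩ := ite_ne_right_iff.1 hb
        rw [← Finset.insert_erase hk, lcmExp_insert]
        exact sup_le hb1.1 (monomial_one_dvd_iff.1 (Dvd.intro _ rfl) b hb2)
      · exact dvd_zero _)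
  refine ⟨u, embed_injective g i ?_⟩
  rw [← bd_embed, hu, ← hw]
  ext1 S
  rw [bd_sum]
  conv_rhs => rw [← sum_restrict_chosenSet g (hI S)]
  refine Finset.sum_congr rfl fun k _ => ?_
  rw [← bd_cone_add_cone_bd k (fun S => restrict (chosenSet g k) (w S)) S, left_eq_add]
  rw [cone]
  split_ifs
  · rw [bd_map, hv, Pi.zero_apply, map_zero, smul_zero]
  · rfl

lemma embed_mem_monomialIdeal {i : ℕ} (v : Face n (i + 1) → MvPolynomial V K)
    (T : Finset (Fin n)) : embed g (i + 1) v T ∈ monomialIdeal g K := by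
  by_cases hT : T.card = i + 1
  · obtain ⟨k, hk⟩ := Finset.card_pos.1 (show 0 < T.card by omega)
    rw [mem_monomialIdeal_iff]
    intro b hb
    exact ⟨k, (Finset.le_sup hk).trans (monomial_one_dvd_iff.1 (Dvd.intro _ rfl) b hb)⟩
  · rw [embed, extend_of_card_ne _ hT, mul_zero]
    exact zero_mem _

lemma extend_single_apply {i : ℕ} (T : Face n i) (S : Finset (Fin n)) :
    extend i (Pi.single T (1 : MvPolynomial V K)) S = if S = T.1 then 1 else 0 := by
  by_cases hS : S.card = i
  · rw [extend_apply _ ⟨S, hS⟩, Pi.single_apply]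
    exact if_congr Subtype.ext_iff rfl rfl
  · rw [extend_of_card_ne _ hS, if_neg]
    rintro rfl
    exact hS T.2

lemma monomial_mem_polyGrading {a : V →₀ ℕ} {m : ℤ} (h : (a.degree : ℤ) = m) :
    monomial a (1 : K) ∈ polyGrading V K m := by
  classical
  rw [mem_polyGrading_iff_coeff]
  intro b hb
  rw [coeff_monomial] at hb
  rw [← (ite_ne_right_iff.1 hb).1, h]

/-- The Taylor resolution of the quotient by a monomial ideal. -/
noncomputable def resolution :
    FreeResolution (Components.quot (monomialIdeal g K) (comp_mem_monomialIdeal g)) where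
  ι i := Face n i
  deg _ T := ((lcmExp g T.1).degree : ℤ)
  d i := diff g i
  aug := (monomialIdeal g K).mkQ ∘ₗ LinearMap.proj (⟨∅, rfl⟩ : Face n 0)
  aug_surjective := by
    refine (Submodule.mkQ_surjective _).comp (LinearMap.proj_surjective _)
  exact_zero v := by
    rw [LinearMap.comp_apply, LinearMap.proj_apply, Submodule.mkQ_apply,
      Submodule.Quotient.mk_eq_zero]
    have h0 : embed g 0 v ∅ = v ⟨∅, rfl⟩ := by
      rw [embed, extend_apply v ⟨∅, rfl⟩, lcmExp, Finset.sup_empty, bot_eq_zero,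
        monomial_zero', C_1, one_mul]
    constructor
    · intro hv
      refine exists_diff_eq g (bd_embed_zero g v) fun T => ?_
      by_cases hT : T = ∅
      · rwa [hT, h0]
      · rw [embed, extend_of_card_ne _ (by simpa using hT), mul_zero]
        exact zero_mem _
    · rintro ⟨u, rfl⟩
      rw [← h0, ← bd_embed]
      exact Submodule.sum_mem _ fun k _ =>
        zsmul_mem (embed_mem_monomialIdeal g u _) _
  exact_succ i v := by
    constructor
    · intro hv
      refine exists_diff_eq g ?_ (embed_mem_monomialIdeal g v)
      rw [bd_embed, hv]
      ext1 T
      simp [embed]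
    · rintro ⟨u, rfl⟩
      refine embed_injective g i ?_
      rw [← bd_embed, ← bd_embed]
      ext1 T
      rw [bd_bd]
      simp [embed]
  pr_aug T := by
    obtain rfl : T = ⟨∅, rfl⟩ := Subtype.ext (Finset.card_eq_zero.1 T.2)
    rw [Components.quot_pr_eq_iff]
    refine ⟨1, ?_, ?_⟩
    · rw [← C_1, ← monomial_zero']
      exact monomial_mem_polyGrading (by simp [lcmExp, bot_eq_zero])
    · simp
  pr_d i T := by
    rw [Components.free_pr_eq_iff]
    intro S
    rw [diff_apply]
    refine Submodule.sum_mem _ fun k _ => zsmul_mem ?_ _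
    rw [extend_single_apply]
    split_ifs with h
    · rw [mul_one, h]
      refine monomial_mem_polyGrading ?_
      have hle : lcmExp g S.1 ≤ lcmExp g T.1 := lcmExp_mono g (h ▸ Finset.subset_insert k S.1)
      have := congrArg Finsupp.degree (tsub_add_cancel_of_le hle)
      rw [map_add] at this
      omega
    · rw [mul_zero]
      exact zero_mem _

lemma constantCoeff_monomial_sub {k : Fin n} {S : Finset (Fin n)} (h : ¬g k ≤ lcmExp g S) :
    constantCoeff (monomial (lcmExp g (insert k S) - lcmExp g S) (1 : K)) = 0 := by
  classical
  rw [constantCoeff_eq, coeff_monomial, if_neg]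
  intro h0
  rw [tsub_eq_zero_iff_le, lcmExp_insert] at h0
  exact h (le_sup_left.trans h0)

/-- The basis element of the Taylor resolution at `T` is minimal if no generator divides the least
common multiple of the generators in `T` other than itself. -/
lemma isMinimalAt_resolution {i : ℕ} (T : Face n i)
    (h : ∀ k, ¬g k ≤ lcmExp g (T.1.erase k)) : (resolution (K := K) g).IsMinimalAt i T := by
  have h1 : ∀ v, constantCoeff (diff (K := K) g i v T) = 0 := by
    intro v
    rw [diff_apply, map_sum]
    refine Finset.sum_eq_zero fun k hk => ?_
    rw [map_zsmul, map_mul, constantCoeff_monomial_sub, zero_mul, smul_zero]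
    have := h k
    rwa [Finset.erase_eq_of_notMem (Finset.mem_compl.1 hk)] at this
  have h2 : ∀ (j : ℕ) (T : Face n (j + 1)) (S : Face n j),
      (∀ k, ¬g k ≤ lcmExp g (T.1.erase k)) →
        constantCoeff (diff (K := K) g j (Pi.single T 1) S) = 0 := by
    intro j T S h
    rw [diff_apply, map_sum]
    refine Finset.sum_eq_zero fun k hk => ?_
    rw [extend_single_apply]
    split_ifs with hT
    · rw [map_zsmul, map_mul, constantCoeff_monomial_sub, zero_mul, smul_zero]
      have := h k
      rwa [← hT, Finset.erase_insert (Finset.mem_compl.1 hk)] at this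
    · simp
  cases i with
  | zero => exact h1
  | succ i => exact ⟨h1, fun S => h2 i T S h⟩

end Taylor

/-! ### Perfect rooted trees -/

namespace RootedTree

variable {V : Type*} {G : SimpleGraph V} {x₀ : V}

lemma level_eq_zero_iff (hG : G.IsTree) {x : V} : level G x₀ x = 0 ↔ x = x₀ :=
  hG.connected.dist_eq_zero_iff.trans eq_comm

lemma exists_dirEdge_of_level_pos (hG : G.IsTree) {y : V} (hy : level G x₀ y ≠ 0) :
    ∃ x, DirEdge G x₀ x y := by
  obtain ⟨p, hp⟩ := hG.connected.exists_walk_length_eq_dist x₀ y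
  have hnil : ¬p.Nil := fun h => hy (by
    rw [level, ← hp, SimpleGraph.Walk.length_eq_zero_iff.2 h])
  have hadj := p.adj_penultimate hnil
  refine ⟨p.penultimate, hadj, ?_⟩
  have h1 : level G x₀ p.penultimate ≤ p.length - 1 := by
    have := SimpleGraph.dist_le p.dropLast
    simpa [level] using this
  have h2 := hG.connected.dist_triangle (u := x₀) (v := p.penultimate) (w := y)
  rw [SimpleGraph.dist_eq_one_iff_adj.2 hadj] at h2
  unfold level at *
  omega

lemma DirEdge.left_unique (hG : G.IsTree) {x x' y : V} (h : DirEdge G x₀ x y)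
    (h' : DirEdge G x₀ x' y) : x = x' := by
  obtain ⟨p, hp⟩ := hG.connected.exists_walk_length_eq_dist x₀ x
  obtain ⟨p', hp'⟩ := hG.connected.exists_walk_length_eq_dist x₀ x'
  have h1 : (p.concat h.1).IsPath := SimpleGraph.Walk.isPath_of_length_eq_dist _ (by
    rw [SimpleGraph.Walk.length_concat, hp]
    exact h.2.symm)
  have h2 : (p'.concat h'.1).IsPath := SimpleGraph.Walk.isPath_of_length_eq_dist _ (by
    rw [SimpleGraph.Walk.length_concat, hp']
    exact h'.2.symm)
  have h3 := congrArg Subtype.val ((hG.isAcyclic.subsingleton_path _ _).elim ⟨_, h1⟩ ⟨_, h2⟩)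
  simpa using congrArg SimpleGraph.Walk.penultimate h3

variable [Fintype V]

lemma level_le_height (x : V) : level G x₀ x ≤ height G x₀ :=
  Finset.le_sup (f := level G x₀) (Finset.mem_univ x)

lemma IsPerfect.exists_dirEdge (hG : IsPerfect G x₀) {x : V}
    (hx : level G x₀ x < height G x₀) : ∃ y, DirEdge G x₀ x y := by
  have h : ¬IsLeaf G x₀ x := fun h => hx.ne (hG.2 x h)
  exact Set.nonempty_of_ncard_ne_zero h

/-- The sum of the outdegrees of the vertices up to a level counts the vertices, other than the
root, up to the next level, since each of these has exactly one parent. -/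
lemma sum_outdegree (hG : G.IsTree) (t : ℕ) :
    ∑ x : V with level G x₀ x + 2 ≤ t, outdegree G x₀ x =
      (Finset.univ.filter fun y : V => level G x₀ y ≠ 0 ∧ level G x₀ y < t).card := by
  classical
  rw [Finset.card_eq_sum_ones]
  have h1 : ∀ x ∈ Finset.univ.filter (fun x : V => level G x₀ x + 2 ≤ t),
      outdegree G x₀ x = (Finset.bipartiteAbove (DirEdge G x₀)
        (Finset.univ.filter fun y : V => level G x₀ y ≠ 0 ∧ level G x₀ y < t) x).card := by
    intro x hx
    rw [outdegree, Set.ncard_eq_toFinset_card']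
    congr 1
    ext y
    simp only [Finset.mem_filter, Finset.mem_univ, true_and, Set.mem_toFinset, Set.mem_ofPred_eq,
      Finset.mem_bipartiteAbove] at hx ⊢
    refine ⟨fun h => ⟨?_, h⟩, fun h => h.2⟩
    have := h.2
    omega
  have h2 : ∀ y ∈ Finset.univ.filter (fun y : V => level G x₀ y ≠ 0 ∧ level G x₀ y < t),
      1 = (Finset.bipartiteBelow (DirEdge G x₀)
        (Finset.univ.filter fun x : V => level G x₀ x + 2 ≤ t) y).card := by
    intro y hy
    simp only [Finset.mem_filter, Finset.mem_univ, true_and] at hy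
    obtain ⟨x, hx⟩ := exists_dirEdge_of_level_pos hG hy.1
    refine (Finset.card_eq_one.2 ⟨x, ?_⟩).symm
    ext x'
    simp only [Finset.mem_bipartiteBelow, Finset.mem_filter, Finset.mem_univ, true_and,
      Finset.mem_singleton]
    constructor
    · exact fun h => h.2.left_unique hG hx
    · rintro rfl
      have := hx.2
      exact ⟨by omega, hx⟩
  rw [Finset.sum_congr rfl h1, Finset.sum_congr rfl h2]
  exact Finset.sum_card_bipartiteAbove_eq_sum_card_bipartiteBelow _

omit [Fintype V] in
lemma IsDirPath.level_eq {s : ℕ} {p : Fin (s + 1) → V} (hp : IsDirPath G x₀ (s + 1) p)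
    (i : Fin (s + 1)) : level G x₀ (p i) = level G x₀ (p 0) + i := by
  induction i using Fin.induction with
  | zero => simp
  | succ i ih =>
    rw [(hp.2 i.castSucc i.succ (by simp)).2, ih]
    simp [add_assoc]

lemma IsDirPath.level_zero_le {s : ℕ} {p : Fin (s + 1) → V} (hp : IsDirPath G x₀ (s + 1) p)
    (hs : s + 1 = height G x₀) : level G x₀ (p 0) ≤ 1 := by
  have h1 := hp.level_eq (Fin.last s)
  have h2 := level_le_height (G := G) (x₀ := x₀) (p (Fin.last s))
  rw [Fin.val_last] at h1
  omega

omit [Fintype V] in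
lemma IsDirPath.eq_of_last_eq (hG : G.IsTree) {s : ℕ} {p q : Fin (s + 1) → V}
    (hp : IsDirPath G x₀ (s + 1) p) (hq : IsDirPath G x₀ (s + 1) q)
    (h : p (Fin.last s) = q (Fin.last s)) : p = q := by
  ext1 i
  induction i using Fin.reverseInduction with
  | last => exact h
  | cast i ih =>
    have h1 := hp.2 i.castSucc i.succ (by simp)
    rw [ih] at h1
    exact h1.left_unique hG (hq.2 i.castSucc i.succ (by simp))

/-- Every vertex other than the root lies on a directed path from level one to the last level. -/
lemma IsPerfect.exists_isDirPath (hG : IsPerfect G x₀) {s : ℕ} (hs : s + 1 = height G x₀) {v : V}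
    (hv : v ≠ x₀) : ∃ p : Fin (s + 1) → V, IsDirPath G x₀ (s + 1) p ∧
      level G x₀ (p 0) = 1 ∧ ∃ i, p i = v := by
  have hv0 : level G x₀ v ≠ 0 := fun h => hv ((level_eq_zero_iff hG.1).1 h)
  choose! par hpar using fun (y : V) (hy : level G x₀ y ≠ 0) => exists_dirEdge_of_level_pos hG.1 hy
  have hlevel : ∀ k z, k ≤ level G x₀ z → level G x₀ (par^[k] z) + k = level G x₀ z := by
    intro k z
    induction k with
    | zero => simp
    | succ k ih =>
      intro hk
      have h1 := ih (by omega)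
      have h2 := (hpar (par^[k] z) (by omega)).2
      rw [Function.iterate_succ_apply']
      omega
  -- descend from `v` to a leaf `z`
  obtain ⟨z, hz, hzv⟩ : ∃ z, level G x₀ z = s + 1 ∧ par^[s + 1 - level G x₀ v] z = v := by
    have hle := level_le_height (G := G) (x₀ := x₀) v
    obtain ⟨m, hm⟩ : ∃ m, level G x₀ v + m = s + 1 := ⟨s + 1 - level G x₀ v, by omega⟩
    rw [← hm, Nat.add_sub_cancel_left]
    clear hv hle
    induction m generalizing v with
    | zero => exact ⟨v, rfl, rfl⟩
    | succ m ih =>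
      obtain ⟨w, hw⟩ := hG.exists_dirEdge (show level G x₀ v < height G x₀ by omega)
      have hw2 := hw.2
      obtain ⟨z, hz, hzw⟩ := ih (v := w) (by omega) (by omega)
      refine ⟨z, by omega, ?_⟩
      rw [Function.iterate_succ_apply', hzw]
      exact (hpar w (by omega)).left_unique hG.1 hw
  have hedge : ∀ i j : Fin (s + 1), (j : ℕ) = i + 1 →
      DirEdge G x₀ (par^[s - i] z) (par^[s - j] z) := by
    intro i j hij
    have h1 := hlevel (s - j) z (by omega)
    rw [show s - (i : ℕ) = s - j + 1 by omega, Function.iterate_succ_apply']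
    exact hpar _ (by omega)
  refine ⟨fun i => par^[s - i] z, ⟨fun i j hij => ?_, hedge⟩, ?_, ?_⟩
  · have h1 := hlevel (s - i) z (by omega)
    have h2 := hlevel (s - j) z (by omega)
    simp only at hij
    rw [hij] at h1
    ext
    omega
  · have h1 := hlevel s z (by omega)
    simp only [Fin.val_zero, Nat.sub_zero]
    omega
  · refine ⟨⟨level G x₀ v - 1, ?_⟩, ?_⟩
    · have := level_le_height (G := G) (x₀ := x₀) v
      omega
    · simp only
      rw [show s - (level G x₀ v - 1) = s + 1 - level G x₀ v by omega, hzv]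

/-! ### The path ideal -/

/-- The exponent of the product of the variables on a path. -/
noncomputable def pathExp {t : ℕ} (p : Fin t → V) : V →₀ ℕ := ∑ i, Finsupp.single (p i) 1

omit [Fintype V] in
open Classical in
lemma pathExp_apply {t : ℕ} {p : Fin t → V} (hp : Function.Injective p) (v : V) :
    pathExp p v = if v ∈ Set.range p then 1 else 0 := by
  rw [pathExp, Finsupp.finsetSum_apply]
  split_ifs with h
  · obtain ⟨i, rfl⟩ := h
    rw [Finset.sum_eq_single i]
    · simp
    · intro j _ hj
      exact Finsupp.single_eq_of_ne (fun h => hj (hp h.symm))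
    · simp
  · refine Finset.sum_eq_zero fun i _ => Finsupp.single_eq_of_ne ?_
    rintro rfl
    exact h ⟨i, rfl⟩

omit [Fintype V] in
lemma pathIdeal_eq_monomialIdeal (K : Type*) [Field K] (G : SimpleGraph V) (x₀ : V) (t : ℕ) {n : ℕ}
    (e : Fin n ≃ {p : Fin t → V // IsDirPath G x₀ t p}) :
    pathIdeal K G x₀ t = Taylor.monomialIdeal (fun k => pathExp (e k).1) K := by
  rw [pathIdeal, Taylor.monomialIdeal]
  congr 1
  have h : ∀ p : Fin t → V, MvPolynomial.monomial (pathExp p) (1 : K) =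
      ∏ i, MvPolynomial.X (p i) := fun p => MvPolynomial.monomial_sum_one _ _
  ext m
  constructor
  · rintro ⟨p, hp, rfl⟩
    exact ⟨e.symm ⟨p, hp⟩, by simp [h]⟩
  · rintro ⟨k, rfl⟩
    exact ⟨_, (e k).2, h _⟩

section Degrees

variable {s n : ℕ} {e : Fin n ≃ {p : Fin (s + 1) → V // IsDirPath G x₀ (s + 1) p}}

omit [Fintype V] in
lemma lcmExp_le_sum (T : Finset (Fin n)) (v : V) :
    Taylor.lcmExp (fun k => pathExp (e k).1) T v ≤ ∑ k ∈ T, pathExp (e k).1 v := by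
  rw [← Finsupp.finsetSum_apply]
  exact Finset.sup_le (f := fun k => pathExp (e k).1) (fun k hk =>
    Finset.single_le_sum (f := fun k => pathExp (e k).1) (fun _ _ => zero_le) hk) v

lemma lcmExp_le_one (T : Finset (Fin n)) (v : V) :
    Taylor.lcmExp (fun k => pathExp (e k).1) T v ≤ 1 := by
  classical
  have : Taylor.lcmExp (fun k => pathExp (e k).1) T ≤ Finsupp.equivFunOnFinite.symm fun _ => 1 :=
    Finset.sup_le fun k _ v => by
      rw [pathExp_apply (e k).2.1]
      split_ifs <;> simp
  exact this v

/-- A path on `height` many vertices contains at most one vertex which is the root or a leaf. -/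
lemma sum_pathExp_le_one (hs : s + 1 = height G x₀) {p : Fin (s + 1) → V}
    (hp : IsDirPath G x₀ (s + 1) p) :
    ∑ v : V with ¬(level G x₀ v ≠ 0 ∧ level G x₀ v < s + 1), pathExp p v ≤ 1 := by
  classical
  simp only [pathExp_apply hp.1]
  rw [Finset.sum_boole, Nat.cast_id, Finset.card_le_one]
  intro v hv w hw
  simp only [Finset.mem_filter, Finset.mem_univ, true_and] at hv hw
  obtain ⟨hv, i, rfl⟩ := hv
  obtain ⟨hw, j, rfl⟩ := hw
  have h1 := hp.level_eq i
  have h2 := hp.level_eq j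
  have h3 := hp.level_zero_le hs
  congr 1
  ext
  omega

lemma degree_lcmExp_le (hs : s + 1 = height G x₀) (T : Finset (Fin n)) :
    (Taylor.lcmExp (fun k => pathExp (e k).1) T).degree ≤ T.card +
      (Finset.univ.filter fun y : V => level G x₀ y ≠ 0 ∧ level G x₀ y < s + 1).card := by
  classical
  rw [Finsupp.degree_eq_sum, add_comm T.card, ← Finset.sum_filter_add_sum_filter_not Finset.univ
    (fun y : V => level G x₀ y ≠ 0 ∧ level G x₀ y < s + 1)]
  refine add_le_add ?_ ?_
  · rw [Finset.card_eq_sum_ones]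
    exact Finset.sum_le_sum fun v _ => lcmExp_le_one T v
  · refine (Finset.sum_le_sum fun v _ => lcmExp_le_sum T v).trans ?_
    rw [Finset.sum_comm, Finset.card_eq_sum_ones]
    exact Finset.sum_le_sum fun k _ => sum_pathExp_le_one hs (e k).2

/-- The least common multiple of the paths that avoid the root has the largest degree that the
number of these paths allows. -/
lemma le_degree_lcmExp (hG : IsPerfect G x₀) (hs : s + 1 = height G x₀) {T : Finset (Fin n)}
    (hT : ∀ k, k ∈ T ↔ level G x₀ ((e k).1 0) = 1) :
    T.card + (Finset.univ.filter fun y : V => level G x₀ y ≠ 0 ∧ level G x₀ y < s + 1).card ≤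
      (Taylor.lcmExp (fun k => pathExp (e k).1) T).degree := by
  classical
  -- a path avoiding the root is determined by the leaf at which it ends
  have h1 : T.card ≤ (Finset.univ.filter fun y : V => level G x₀ y = s + 1).card := by
    refine Finset.card_le_card_of_injOn (fun k => (e k).1 (Fin.last s)) (fun k hk => ?_)
      fun k _ l _ h => e.injective (Subtype.ext ((e k).2.eq_of_last_eq hG.1 (e l).2 h))
    have := (e k).2.level_eq (Fin.last s)
    rw [(hT k).1 hk, Fin.val_last] at this
    simp only [Finset.coe_filter, Finset.mem_univ, true_and, Set.mem_ofPred_eq]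
    omega
  have h2 : ∀ v, v ≠ x₀ → 1 ≤ Taylor.lcmExp (fun k => pathExp (e k).1) T v := by
    intro v hv
    obtain ⟨p, hp, hp1, hpv⟩ := hG.exists_isDirPath hs hv
    have hk : e.symm ⟨p, hp⟩ ∈ T := (hT _).2 (by simpa using hp1)
    have := Finset.le_sup (f := fun k => pathExp (e k).1) hk v
    simp only [Equiv.apply_symm_apply, pathExp_apply hp.1] at this
    rwa [if_pos (Set.mem_range.2 hpv)] at this
  calc _ ≤ (Finset.univ.filter fun y : V => level G x₀ y = s + 1).card +
        (Finset.univ.filter fun y : V => level G x₀ y ≠ 0 ∧ level G x₀ y < s + 1).card :=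
        Nat.add_le_add_right h1 _
    _ = ((Finset.univ.filter fun y : V => level G x₀ y = s + 1) ∪
        (Finset.univ.filter fun y : V => level G x₀ y ≠ 0 ∧ level G x₀ y < s + 1)).card := by
        rw [Finset.card_union_of_disjoint]
        rw [Finset.disjoint_filter]
        intro v _ h h'
        omega
    _ ≤ ∑ v ∈ ((Finset.univ.filter fun y : V => level G x₀ y = s + 1) ∪
        (Finset.univ.filter fun y : V => level G x₀ y ≠ 0 ∧ level G x₀ y < s + 1)),
          Taylor.lcmExp (fun k => pathExp (e k).1) T v := by
        rw [Finset.card_eq_sum_ones]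
        refine Finset.sum_le_sum fun v hv => h2 v ?_
        rintro rfl
        have h0 : level G v v = 0 := (level_eq_zero_iff hG.1).2 rfl
        simp [h0] at hv
    _ ≤ _ := by
        rw [Finsupp.degree_eq_sum]
        exact Finset.sum_le_sum_of_subset (Finset.subset_univ _)

/-- A path avoiding the root is the only such path through its leaf, and the other paths contain
the root. Therefore the paths avoiding the root form a minimal basis element of the Taylor
resolution. -/
lemma not_pathExp_le_lcmExp (hG : G.IsTree) (hs : s + 1 = height G x₀) {T : Finset (Fin n)}
    (hT : ∀ k, k ∈ T ↔ level G x₀ ((e k).1 0) = 1) (k : Fin n) :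
    ¬pathExp (e k).1 ≤ Taylor.lcmExp (fun k => pathExp (e k).1) (T.erase k) := by
  classical
  suffices h : ∃ i, ∀ l ∈ T.erase k, (e k).1 i ∉ Set.range (e l).1 by
    obtain ⟨i, hi⟩ := h
    intro hle
    have h1 := (hle ((e k).1 i)).trans (lcmExp_le_sum (T.erase k) _)
    rw [pathExp_apply (e k).2.1, if_pos (Set.mem_range_self i), Finset.sum_eq_zero] at h1
    · exact Nat.not_succ_le_zero _ h1
    · intro l hl
      rw [pathExp_apply (e l).2.1, if_neg (hi l hl)]
  have hk0 := (e k).2.level_zero_le hs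
  by_cases hk : k ∈ T
  -- the last vertex of the path separates it from the others if it avoids the root, and the first
  -- vertex, which is the root, if it does not
  · refine ⟨Fin.last s, fun l hl => ?_⟩
    rintro ⟨j, hj⟩
    rw [Finset.mem_erase] at hl
    have h1 := (e k).2.level_eq (Fin.last s)
    have h2 := (e l).2.level_eq j
    have h3 := (hT k).1 hk
    have h4 := (hT l).1 hl.2
    rw [Fin.val_last] at h1
    rw [hj] at h2
    obtain rfl : j = Fin.last s := by
      ext
      rw [Fin.val_last]
      omega
    exact hl.1 (e.injective (Subtype.ext ((e l).2.eq_of_last_eq hG (e k).2 hj)))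
  · refine ⟨0, fun l hl => ?_⟩
    rintro ⟨j, hj⟩
    have h1 := (hT l).1 (Finset.mem_of_mem_erase hl)
    have h2 := (e l).2.level_eq j
    rw [hT k] at hk
    rw [hj] at h2
    omega

end Degrees

end RootedTree

theorem mainTheorem10 {K : Type*} [Field K] {V : Type*} [Fintype V]
    (G : SimpleGraph V) (x₀ : V) (hG : RootedTree.IsPerfect G x₀)
    (hht : 1 ≤ RootedTree.height G x₀) (t : ℕ) (ht : t = RootedTree.height G x₀) :
    GradedRes.IsRegularityQuot (RootedTree.pathIdeal K G x₀ t)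
      ((∑ x : V with RootedTree.level G x₀ x + 2 ≤ RootedTree.height G x₀,
        RootedTree.outdegree G x₀ x : ℕ) : ℤ) := by
  classical
  rw [RootedTree.sum_outdegree hG.1, ← ht]
  obtain ⟨s, rfl⟩ : ∃ s, t = s + 1 := ⟨t - 1, by omega⟩
  obtain ⟨n, ⟨e'⟩⟩ := Finite.exists_equiv_fin
    {p : Fin (s + 1) → V // RootedTree.IsDirPath G x₀ (s + 1) p}
  let e := e'.symm
  rw [RootedTree.pathIdeal_eq_monomialIdeal K G x₀ (s + 1) e]
  let T : Finset (Fin n) :=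
    Finset.univ.filter fun k => RootedTree.level G x₀ ((e k).1 0) = 1
  have hT : ∀ k, k ∈ T ↔ RootedTree.level G x₀ ((e k).1 0) = 1 := fun k => by simp [T]
  refine (Taylor.resolution fun k => RootedTree.pathExp (e k).1).isRegularityQuot _ ?_
    (Taylor.isMinimalAt_resolution _ ⟨T, rfl⟩ (RootedTree.not_pathExp_le_lcmExp hG.1 ht hT)) ?_
  · rintro i ⟨S, rfl⟩
    rw [← Nat.cast_add]
    exact Int.ofNat_le.2 (RootedTree.degree_lcmExp_le ht S)
  · rw [← Nat.cast_add]
    exact congrArg Nat.cast (le_antisymm (RootedTree.degree_lcmExp_le ht T)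
      (RootedTree.le_degree_lcmExp hG ht hT))
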